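/- Let $\mathbb D=\{z\in\mathbb C:|z|<1\}$, and let $f:\mathbb D\to\mathbb C$ be an infinitesimal generator, that is, $f$ is holomorphic and for every $z\in\mathbb D$ the Cauchy problem $\frac{\partial u(t,z)}{\partial t}+f(u(t,z))=0$, $u(0,z)=z$, has a unique solution $u(t,z)\in\mathbb D$ defined for all $t\ge 0$. Suppose that $f(0)=0$ and that $q:=f'(0)$ satisfies $\operatorname{Re} q>0$. Then for every $r>0$ the nonlinear resolvent $G_r=(\mathrm{Id}+rf)^{-1}$ is a well-defined holomorphic self-mapping of $\mathbb D$: for each $w\in\mathbb D$, $G_r(w)$ is the unique $z\in\mathbb D$ with $z+rf(z)=w$. Moreover, the normalized resolvents $(1+rq)G_r(z)$ converge to $z$ as $r\to\infty$, uniformly on compact subsets of $\mathbb D$. -/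

import Mathlib

open Set Filter Topology Metric

/-- The function `u` solves the Cauchy problem `u' + f(u) = 0`, `u(0) = z` for all times `t ≥ 0`
and stays in the open unit disk (at `t = 0` the derivative is the right-hand one). -/
def IsCauchySolution (f : ℂ → ℂ) (z : ℂ) (u : ℝ → ℂ) : Prop :=
  u 0 = z ∧ ∀ t : ℝ, 0 ≤ t →
    u t ∈ ball (0 : ℂ) 1 ∧ HasDerivWithinAt u (-f (u t)) (Ici 0) t

/-- `f` is an infinitesimal generator on the open unit disk: it is holomorphic there, and for
every point `z` of the disk the Cauchy problem has a unique solution in the disk, defined for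
all `t ≥ 0`. -/
def IsGenerator (f : ℂ → ℂ) : Prop :=
  DifferentiableOn ℂ f (ball 0 1) ∧
    ∀ z ∈ ball (0 : ℂ) 1, ∃ u : ℝ → ℂ, IsCauchySolution f z u ∧
      ∀ v : ℝ → ℂ, IsCauchySolution f z v → EqOn v u (Ici 0)

/-- The nonlinear resolvent `G_r = (Id + r f)⁻¹`, the inverse of `Id + r f` restricted to the open
unit disk: its value at `w` is a point `z` of the disk with `z + r f(z) = w`. -/
noncomputable def nonlinearResolvent (f : ℂ → ℂ) (r : ℝ) : ℂ → ℂ :=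
  Function.invFunOn (fun z : ℂ => z + (r : ℂ) * f z) (ball 0 1)

/-- `G` is a holomorphic self-mapping of the open unit disk, and for every `w` in the disk `G w` is
the one and only point `z` of the disk with `z + r f(z) = w`. -/
def IsResolventMap (f : ℂ → ℂ) (r : ℝ) (G : ℂ → ℂ) : Prop :=
  DifferentiableOn ℂ G (ball 0 1) ∧ MapsTo G (ball 0 1) (ball 0 1) ∧
    ∀ w ∈ ball (0 : ℂ) 1, ∀ z ∈ ball (0 : ℂ) 1, z + (r : ℂ) * f z = w ↔ z = G w

/-!
Let `u(t, z)` be the solution starting at `z`. The difference `D` of two solutions satisfies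
`D' = slope · D`, so the difference quotient of `u(t, ·)` is `exp (∫ slope)`; letting the initial
points merge gives `exp (-∫ f'(u))`, and `u(t, ·)` is holomorphic. It fixes `0`, so the Schwarz
lemma gives `‖u(t, z)‖ ≤ ‖z‖`, and the derivative at `t = 0` yields `f z = z * p z` with
`0 ≤ Re p`. As `Re p(0) = Re q > 0`, the open mapping theorem makes `Re p` positive everywhere.

Hence `z + r f(z) = w` says that `z` is fixed by `z ↦ w / (1 + r p(z))`, which maps the disk into
the closed disk of radius `‖w‖ < 1`. Such a map strictly contracts the pseudo-hyperbolic metric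
(Earle–Hamilton), so it has exactly one fixed point; as a locally uniform limit of iterates, that
point depends holomorphically on `w`.

Finally `w - (1 + r q) z = r z (p(z) - p(0))` for `z = G_r(w)`. If `Re p ≥ m > 0` on a closed disk
containing `w`, and so `z`, then `r ‖z‖ ≤ 1 / m`; thus `z → 0` and the error tends to `0` uniformly.
-/

section EarleHamilton

open ComplexConjugate Function

/-- The automorphism of the unit disk that carries `a` to `0`. Its modulus `‖diskAut a z‖` is the
pseudo-hyperbolic distance between `a` and `z`. -/
noncomputable def diskAut (a z : ℂ) : ℂ := (z - a) / (1 - conj a * z)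

variable {a b z : ℂ} {s : ℝ} {h : ℂ → ℂ} {H : ℂ → ℂ → ℂ} {U : Set ℂ}

theorem diskAut_denom_ne_zero (ha : ‖a‖ < 1) (hz : ‖z‖ < 1) : 1 - conj a * z ≠ 0 := by
  have hlt : ‖conj a * z‖ < 1 := by
    rw [norm_mul, RCLike.norm_conj]
    exact mul_lt_one_of_nonneg_of_lt_one_left (norm_nonneg a) ha hz.le
  exact sub_ne_zero.mpr fun heq => by simp [← heq] at hlt

theorem one_sub_norm_sq_diskAut (ha : ‖a‖ < 1) (hz : ‖z‖ < 1) :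
    1 - ‖diskAut a z‖ ^ 2 = (1 - ‖a‖ ^ 2) * (1 - ‖z‖ ^ 2) / ‖1 - conj a * z‖ ^ 2 := by
  have hden := norm_ne_zero_iff.mpr (diskAut_denom_ne_zero ha hz)
  rw [diskAut, norm_div, div_pow, eq_div_iff (pow_ne_zero 2 hden), sub_mul,
    div_mul_cancel₀ _ (pow_ne_zero 2 hden)]
  simp only [Complex.sq_norm, Complex.normSq_apply, Complex.sub_re, Complex.sub_im, Complex.mul_re,
    Complex.mul_im, Complex.conj_re, Complex.conj_im, Complex.one_re, Complex.one_im]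
  ring

theorem norm_diskAut_lt_one (ha : ‖a‖ < 1) (hz : ‖z‖ < 1) : ‖diskAut a z‖ < 1 := by
  have ha' : 0 < 1 - ‖a‖ ^ 2 := by nlinarith [norm_nonneg a]
  have hz' : 0 < 1 - ‖z‖ ^ 2 := by nlinarith [norm_nonneg z]
  have hden := norm_pos_iff.mpr (diskAut_denom_ne_zero ha hz)
  have hpos : 0 < 1 - ‖diskAut a z‖ ^ 2 := by
    rw [one_sub_norm_sq_diskAut ha hz]
    positivity
  exact lt_of_pow_lt_pow_left₀ 2 zero_le_one (by linarith)

theorem norm_diskAut_le_of_mem_closedBall (hs : s < 1) (ha : ‖a‖ ≤ s) (hz : ‖z‖ ≤ s) :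
    ‖diskAut a z‖ ≤ 2 * s / (1 + s ^ 2) := by
  have hs0 : 0 ≤ s := (norm_nonneg a).trans ha
  have ha1 := ha.trans_lt hs
  have hz1 := hz.trans_lt hs
  have hden : ‖1 - conj a * z‖ ≤ 1 + s ^ 2 := by
    refine (norm_sub_le _ _).trans ?_
    rw [norm_one, norm_mul, RCLike.norm_conj, sq]
    gcongr
  have hden0 := norm_pos_iff.mpr (diskAut_denom_ne_zero ha1 hz1)
  have hnum : 0 ≤ 1 - s ^ 2 := by nlinarith
  have hsq : (1 - s ^ 2) * (1 - s ^ 2) / (1 + s ^ 2) ^ 2 ≤ 1 - ‖diskAut a z‖ ^ 2 := by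
    rw [one_sub_norm_sq_diskAut ha1 hz1]
    have ha' : 1 - s ^ 2 ≤ 1 - ‖a‖ ^ 2 := by gcongr
    have hz' : 1 - s ^ 2 ≤ 1 - ‖z‖ ^ 2 := by gcongr
    exact div_le_div₀ (mul_nonneg (hnum.trans ha') (hnum.trans hz'))
      (mul_le_mul ha' hz' hnum (hnum.trans ha')) (pow_pos hden0 2) (by gcongr)
  have hid : (2 * s / (1 + s ^ 2)) ^ 2 = 1 - (1 - s ^ 2) * (1 - s ^ 2) / (1 + s ^ 2) ^ 2 := by
    field_simp
    ring
  exact le_of_sq_le_sq (by linarith) (by positivity)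

theorem norm_sub_le_two_mul_norm_diskAut (ha : ‖a‖ < 1) (hz : ‖z‖ < 1) :
    ‖z - a‖ ≤ 2 * ‖diskAut a z‖ := by
  have hden : ‖1 - conj a * z‖ ≤ 2 := by
    refine (norm_sub_le _ _).trans ?_
    rw [norm_one, norm_mul, RCLike.norm_conj]
    nlinarith [norm_nonneg a, norm_nonneg z]
  calc ‖z - a‖ = ‖1 - conj a * z‖ * ‖diskAut a z‖ := by
        rw [← norm_mul, diskAut, mul_div_cancel₀ _ (diskAut_denom_ne_zero ha hz)]
    _ ≤ 2 * ‖diskAut a z‖ := by gcongr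

theorem diskAut_self (a : ℂ) : diskAut a a = 0 := by simp [diskAut]

theorem diskAut_neg_zero (a : ℂ) : diskAut (-a) 0 = a := by simp [diskAut]

theorem diskAut_neg_diskAut (ha : ‖a‖ < 1) (hz : ‖z‖ < 1) : diskAut (-a) (diskAut a z) = z := by
  have hz' := diskAut_denom_ne_zero ha hz
  have ha' := diskAut_denom_ne_zero ha ha
  have hnum : diskAut a z + a = z * (1 - conj a * a) / (1 - conj a * z) := by
    rw [diskAut, eq_div_iff hz', add_mul, div_mul_cancel₀ _ hz']
    ring
  have hden : 1 + conj a * diskAut a z = (1 - conj a * a) / (1 - conj a * z) := by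
    rw [diskAut, eq_div_iff hz', add_mul, mul_assoc, div_mul_cancel₀ _ hz']
    ring
  rw [diskAut, sub_neg_eq_add, map_neg, neg_mul, sub_neg_eq_add, hnum, hden,
    div_div_div_cancel_right₀ hz', mul_div_cancel_right₀ _ ha']

theorem differentiableOn_diskAut (ha : ‖a‖ < 1) : DifferentiableOn ℂ (diskAut a) (ball 0 1) :=
  (differentiableOn_id.sub_const a).div ((differentiableOn_const 1).sub
    (differentiableOn_id.const_mul (conj a)))
    fun _ hz => diskAut_denom_ne_zero ha (mem_ball_zero_iff.mp hz)

theorem mapsTo_diskAut (ha : ‖a‖ < 1) : MapsTo (diskAut a) (ball 0 1) (ball 0 1) := fun _ hz =>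
  mem_ball_zero_iff.mpr (norm_diskAut_lt_one ha (mem_ball_zero_iff.mp hz))

/-- This is the Schwarz lemma after `a` and `h a` are moved to `0`; the factor `2 s / (1 + s ^ 2)`
is the pseudo-hyperbolic diameter of the closed disk of radius `s`. -/
theorem norm_diskAut_map_le (hs : s < 1) (hd : DifferentiableOn ℂ h (ball 0 1))
    (hm : MapsTo h (ball 0 1) (closedBall 0 s)) (ha : ‖a‖ < 1) (hb : ‖b‖ < 1) :
    ‖diskAut (h a) (h b)‖ ≤ 2 * s / (1 + s ^ 2) * ‖diskAut a b‖ := by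
  have hna : ‖-a‖ < 1 := by rwa [norm_neg]
  have hm' : ∀ z ∈ ball (0 : ℂ) 1, ‖h z‖ ≤ s := fun z hz => mem_closedBall_zero_iff.mp (hm hz)
  have hha := hm' a (mem_ball_zero_iff.mpr ha)
  let g : ℂ → ℂ := diskAut (h a) ∘ h ∘ diskAut (-a)
  have hg0 : g 0 = 0 := by simp only [g, comp_apply, diskAut_neg_zero, diskAut_self]
  have hgd : DifferentiableOn ℂ g (ball 0 1) :=
    (differentiableOn_diskAut (hha.trans_lt hs)).comp
      (hd.comp (differentiableOn_diskAut hna) (mapsTo_diskAut hna)) fun z hz =>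
        mem_ball_zero_iff.mpr ((hm' _ (mapsTo_diskAut hna hz)).trans_lt hs)
  have hgm : MapsTo g (ball 0 1) (closedBall (g 0) (2 * s / (1 + s ^ 2))) := fun z hz => by
    rw [hg0, mem_closedBall_zero_iff]
    exact norm_diskAut_le_of_mem_closedBall hs hha (hm' _ (mapsTo_diskAut hna hz))
  have hschwarz := Complex.dist_le_div_mul_dist_of_mapsTo_ball hgd hgm
    (mem_ball_zero_iff.mpr (norm_diskAut_lt_one ha hb))
  simpa only [hg0, div_one, dist_zero_right, g, comp_apply, diskAut_neg_diskAut ha hb]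
    using hschwarz

theorem dist_iterate_le (hs : s < 1) (hd : DifferentiableOn ℂ h (ball 0 1))
    (hm : MapsTo h (ball 0 1) (closedBall 0 s)) (ha : a ∈ ball 0 1) (hb : b ∈ ball 0 1) (n : ℕ) :
    dist (h^[n] a) (h^[n] b) ≤ 2 * (2 * s / (1 + s ^ 2)) ^ n := by
  have hball : MapsTo h (ball 0 1) (ball 0 1) := hm.mono_right (closedBall_subset_ball hs)
  have hs0 : 0 ≤ s := nonempty_closedBall.mp ⟨_, hm ha⟩
  have hmem : ∀ z ∈ ball (0 : ℂ) 1, ∀ n, ‖h^[n] z‖ < 1 := fun z hz n =>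
    mem_ball_zero_iff.mp (hball.iterate n hz)
  have hpseudo : ‖diskAut (h^[n] b) (h^[n] a)‖ ≤ (2 * s / (1 + s ^ 2)) ^ n := by
    induction n with
    | zero => simpa using (norm_diskAut_lt_one (hmem b hb 0) (hmem a ha 0)).le
    | succ n ih =>
      rw [iterate_succ_apply', iterate_succ_apply', pow_succ']
      exact (norm_diskAut_map_le hs hd hm (hmem b hb n) (hmem a ha n)).trans (by gcongr)
  rw [dist_eq_norm]
  exact (norm_sub_le_two_mul_norm_diskAut (hmem b hb n) (hmem a ha n)).trans (by gcongr)

theorem two_mul_div_one_add_sq_lt_one (hs : s < 1) : 2 * s / (1 + s ^ 2) < 1 := by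
  rw [div_lt_one (by positivity)]
  nlinarith [sq_pos_of_pos (sub_pos.mpr hs)]

theorem dist_iterate_fixedPoint_le (hs : s < 1) (hd : DifferentiableOn ℂ h (ball 0 1))
    (hm : MapsTo h (ball 0 1) (closedBall 0 s)) (ha : a ∈ ball 0 1) (hfix : IsFixedPt h a)
    (hb : b ∈ ball 0 1) (n : ℕ) : dist (h^[n] b) a ≤ 2 * (2 * s / (1 + s ^ 2)) ^ n := by
  simpa only [hfix.iterate n |>.eq] using dist_iterate_le hs hd hm hb ha n

theorem existsUnique_isFixedPt (hs : s < 1) (hd : DifferentiableOn ℂ h (ball 0 1))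
    (hm : MapsTo h (ball 0 1) (closedBall 0 s)) : ∃! a, a ∈ ball 0 1 ∧ IsFixedPt h a := by
  have hc1 := two_mul_div_one_add_sq_lt_one hs
  have h0 : (0 : ℂ) ∈ ball (0 : ℂ) 1 := mem_ball_self one_pos
  have hs0 : 0 ≤ s := nonempty_closedBall.mp ⟨_, hm h0⟩
  have hball : MapsTo h (ball 0 1) (ball 0 1) := hm.mono_right (closedBall_subset_ball hs)
  have hcauchy : CauchySeq fun n => h^[n] 0 := by
    refine cauchySeq_of_le_geometric _ 2 hc1 fun n => ?_
    rw [iterate_succ_apply]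
    exact dist_iterate_le hs hd hm h0 (hball h0) n
  obtain ⟨a, hlim⟩ := cauchySeq_tendsto_of_complete hcauchy
  have ha : a ∈ ball (0 : ℂ) 1 := by
    refine closedBall_subset_ball hs (isClosed_closedBall.mem_of_tendsto
      (hlim.comp (tendsto_add_atTop_nat 1)) (Eventually.of_forall fun n => ?_))
    rw [comp_apply, iterate_succ_apply']
    exact hm (hball.iterate n h0)
  have hfix : IsFixedPt h a :=
    isFixedPt_of_tendsto_iterate hlim (hd.continuousOn.continuousAt (isOpen_ball.mem_nhds ha))
  refine ⟨a, ⟨ha, hfix⟩, fun b ⟨hb, hbfix⟩ => ?_⟩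
  have hpow := (tendsto_pow_atTop_nhds_zero_of_lt_one (by positivity) hc1).const_mul 2
  rw [mul_zero] at hpow
  refine dist_le_zero.mp (ge_of_tendsto' hpow fun n => ?_)
  simpa only [hbfix.iterate n |>.eq] using dist_iterate_fixedPoint_le hs hd hm ha hfix hb n

theorem differentiableOn_fixedPoint (hU : IsOpen U) (hs : s < 1) {φ : ℂ → ℂ}
    (hd : DifferentiableOn ℂ (uncurry H) (U ×ˢ ball 0 1))
    (hm : ∀ w ∈ U, MapsTo (H w) (ball 0 1) (closedBall 0 s))
    (hφ : MapsTo φ U (ball 0 1)) (hfix : ∀ w ∈ U, IsFixedPt (H w) (φ w)) :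
    DifferentiableOn ℂ φ U := by
  have h0 : (0 : ℂ) ∈ ball (0 : ℂ) 1 := mem_ball_self one_pos
  have hsec : ∀ w ∈ U, DifferentiableOn ℂ (H w) (ball 0 1) := fun w hw =>
    hd.comp ((differentiableOn_const w).prodMk differentiableOn_id) fun z hz => ⟨hw, hz⟩
  have hmem : ∀ n, ∀ w ∈ U, (H w)^[n] 0 ∈ ball (0 : ℂ) 1 := fun n w hw =>
    ((hm w hw).mono_right (closedBall_subset_ball hs)).iterate n h0
  have hiter : ∀ n, DifferentiableOn ℂ (fun w => (H w)^[n] 0) U := fun n => by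
    induction n with
    | zero => exact differentiableOn_const 0
    | succ n ih =>
      simp only [iterate_succ_apply']
      exact hd.comp (differentiableOn_id.prodMk ih) fun w hw => ⟨hw, hmem n w hw⟩
  have hunif : TendstoUniformlyOn (fun n w => (H w)^[n] 0) φ atTop U := by
    rw [Metric.tendstoUniformlyOn_iff]
    intro ε hε
    rcases U.eq_empty_or_nonempty with rfl | ⟨w₀, hw₀⟩
    · simp
    have hs0 : 0 ≤ s := nonempty_closedBall.mp ⟨_, hm w₀ hw₀ h0⟩
    have hpow := (tendsto_pow_atTop_nhds_zero_of_lt_one (by positivity)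
      (two_mul_div_one_add_sq_lt_one hs)).const_mul 2
    rw [mul_zero] at hpow
    filter_upwards [hpow.eventually_lt_const hε] with n hn w hw
    rw [dist_comm]
    exact (dist_iterate_fixedPoint_le hs (hsec w hw) (hm w hw) (hφ hw) (hfix w hw) h0 n).trans_lt hn
  exact hunif.tendstoLocallyUniformlyOn.differentiableOn (Eventually.of_forall hiter) hU

end EarleHamilton

section HolomorphicFlow

open MeasureTheory intervalIntegral
open scoped NNReal

theorem exists_lipschitzOnWith_closedBall {E : Type*} [NormedAddCommGroup E] [NormedSpace ℂ E]
    [CompleteSpace E] {F : ℂ → E} {K Ω : Set ℂ} (hK : IsCompact K) (hΩ : IsOpen Ω) (hKΩ : K ⊆ Ω)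
    (hF : DifferentiableOn ℂ F Ω) :
    ∃ ρ > 0, ∃ L : ℝ≥0, ∀ x ∈ K, closedBall x ρ ⊆ Ω ∧ LipschitzOnWith L F (closedBall x ρ) := by
  obtain ⟨ρ, hρ, hsub⟩ := hK.exists_cthickening_subset_open hΩ hKΩ
  obtain ⟨L, hL⟩ := hK.cthickening.exists_bound_of_continuousOn
    ((hF.deriv hΩ).continuousOn.mono hsub)
  refine ⟨ρ, hρ, L.toNNReal, fun x hx => ?_⟩
  have hball : closedBall x ρ ⊆ cthickening ρ K := closedBall_subset_cthickening hx ρ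
  refine ⟨hball.trans hsub, (convex_closedBall x ρ).lipschitzOnWith_of_nnnorm_deriv_le
    (fun y hy => hF.differentiableAt (hΩ.mem_nhds (hsub (hball hy)))) fun y hy => ?_⟩
  exact NNReal.le_toNNReal_of_coe_le (hL y (hball hy))

section NormedSpace

variable {E : Type*} [NormedAddCommGroup E] [NormedSpace ℝ E] {v : ℝ → E → E} {γ u : ℝ → E}
  {a b ρ : ℝ} {L : ℝ≥0}

/-- The rate is `L + 1` rather than `L` because the fencing argument needs the bound to grow
strictly faster than the distance. -/
theorem dist_integralCurve_le (hγ : IsIntegralCurveOn γ v (Icc a b))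
    (hu : IsIntegralCurveOn u v (Icc a b))
    (hv : ∀ t ∈ Icc a b, LipschitzOnWith L (v t) (closedBall (γ t) ρ)) (hne : u a ≠ γ a)
    (hρ : dist (u a) (γ a) * Real.exp ((L + 1) * (b - a)) ≤ ρ) {t : ℝ} (ht : t ∈ Icc a b) :
    dist (u t) (γ t) ≤ dist (u a) (γ a) * Real.exp ((L + 1) * (t - a)) := by
  have hδ : 0 < dist (u a) (γ a) := dist_pos.mpr hne
  have hB : ∀ t, HasDerivAt (fun t => dist (u a) (γ a) * Real.exp ((L + 1) * (t - a)))
      ((L + 1) * (dist (u a) (γ a) * Real.exp ((L + 1) * (t - a)))) t := fun t => by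
    refine ((((hasDerivAt_id t).sub_const a).const_mul ((L : ℝ) + 1)).exp.const_mul
      (dist (u a) (γ a))).congr_deriv ?_
    rw [id]
    ring
  rw [dist_eq_norm (u t)]
  refine image_norm_le_of_norm_deriv_right_lt_deriv_boundary (f := fun t => u t - γ t)
    (hu.continuousOn.sub hγ.continuousOn) (fun t ht => ((hu t (Ico_subset_Icc_self ht)).sub
      (hγ t (Ico_subset_Icc_self ht))).mono_of_mem_nhdsWithin (Icc_mem_nhdsGE_of_mem ht))
    (by simp [dist_eq_norm]) hB (fun t ht heq => ?_) ht
  rw [← dist_eq_norm] at heq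
  have hpos : 0 < dist (u t) (γ t) := heq ▸ by positivity
  have hmem : u t ∈ closedBall (γ t) ρ := by
    rw [mem_closedBall, heq]
    refine le_trans ?_ hρ
    gcongr
    exact ht.2.le
  have hlip := (hv t (Ico_subset_Icc_self ht)).dist_le_mul _ hmem _
    (mem_closedBall_self (dist_nonneg.trans hmem))
  rw [← dist_eq_norm, ← heq]
  linarith

theorem tendstoUniformlyOn_flow {Φ : E → ℝ → E} {w : E} (hρ : 0 < ρ)
    (hv : ∀ t ∈ Icc a b, LipschitzOnWith L (v t) (closedBall (Φ w t) ρ))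
    (hΦ : ∀ᶠ z in 𝓝 w, IsIntegralCurveOn (Φ z) v (Icc a b)) (hinit : ∀ᶠ z in 𝓝 w, Φ z a = z) :
    TendstoUniformlyOn Φ (Φ w) (𝓝 w) (Icc a b) := by
  rw [Metric.tendstoUniformlyOn_iff]
  intro ε hε
  have hlim : Tendsto (fun z => dist z w * Real.exp ((L + 1) * (b - a))) (𝓝 w) (𝓝 0) :=
    Continuous.tendsto' (by fun_prop) _ _ (by rw [dist_self, zero_mul])
  filter_upwards [hΦ, hinit, hlim.eventually_le_const hρ, hlim.eventually_lt_const hε]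
    with z hz hz0 hzρ hzε t ht
  rcases eq_or_ne z w with rfl | hne
  · rwa [dist_self]
  have hw0 := hinit.self_of_nhds
  calc dist (Φ w t) (Φ z t) = dist (Φ z t) (Φ w t) := dist_comm _ _
    _ ≤ dist (Φ z a) (Φ w a) * Real.exp ((L + 1) * (t - a)) :=
        dist_integralCurve_le hΦ.self_of_nhds hz hv (by rwa [hz0, hw0]) (by rwa [hz0, hw0]) ht
    _ ≤ dist z w * Real.exp ((L + 1) * (b - a)) := by
        rw [hz0, hw0]
        gcongr
        exact ht.2
    _ < ε := hzε

theorem integralCurve_ne (hγ : IsIntegralCurveOn γ v (Icc a b))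
    (hu : IsIntegralCurveOn u v (Icc a b))
    {S : ℝ → Set E} (hv : ∀ t ∈ Icc a b, LipschitzOnWith L (v t) (S t))
    (hγS : ∀ t ∈ Icc a b, γ t ∈ S t) (huS : ∀ t ∈ Icc a b, u t ∈ S t) (hne : u a ≠ γ a) {t : ℝ}
    (ht : t ∈ Icc a b) : u t ≠ γ t := fun heq => by
  have hsub : Icc a t ⊆ Icc a b := Icc_subset_Icc_right ht.2
  have hsub' : Ioc a t ⊆ Icc a b := Ioc_subset_Icc_self.trans hsub
  have hleft : ∀ {c : ℝ → E}, IsIntegralCurveOn c v (Icc a b) → ∀ x ∈ Ioc a t,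
      HasDerivWithinAt c (v x (c x)) (Iic x) x := fun hc x hx =>
    ((hc.mono hsub) x (Ioc_subset_Icc_self hx)).mono_of_mem_nhdsWithin (Icc_mem_nhdsLE_of_mem hx)
  exact hne (ODE_solution_unique_of_mem_Icc_left (fun x hx => hv x (hsub' hx))
    (hu.continuousOn.mono hsub) (hleft hu) (fun x hx => huS x (hsub' hx))
    (hγ.continuousOn.mono hsub) (hleft hγ) (fun x hx => hγS x (hsub' hx)) heq
    (left_mem_Icc.mpr ht.1))

theorem eventually_flow_mem_closedBall_diff_singleton {Φ : E → ℝ → E} {w : E} (hρ : 0 < ρ)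
    (hv : ∀ t ∈ Icc a b, LipschitzOnWith L (v t) (closedBall (Φ w t) ρ))
    (hΦ : ∀ᶠ z in 𝓝 w, IsIntegralCurveOn (Φ z) v (Icc a b)) (hinit : ∀ᶠ z in 𝓝 w, Φ z a = z) :
    ∀ᶠ z in 𝓝[≠] w, ∀ t ∈ Icc a b, Φ z t ∈ closedBall (Φ w t) ρ \ {Φ w t} := by
  have hunif := Metric.tendstoUniformlyOn_iff.mp (tendstoUniformlyOn_flow hρ hv hΦ hinit) ρ hρ
  filter_upwards [nhdsWithin_le_nhds hunif, nhdsWithin_le_nhds hΦ, nhdsWithin_le_nhds hinit,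
    self_mem_nhdsWithin] with z hz hcurve hz0 hne t ht
  have hball : ∀ t ∈ Icc a b, Φ z t ∈ closedBall (Φ w t) ρ := fun t ht =>
    mem_closedBall'.mpr (hz t ht).le
  exact ⟨hball t ht, integralCurve_ne hΦ.self_of_nhds hcurve hv
    (fun t _ => mem_closedBall_self hρ.le) hball (by rwa [hz0, hinit.self_of_nhds]) ht⟩

end NormedSpace

section Slope

variable {𝕜 : Type*} [NontriviallyNormedField 𝕜] {F : 𝕜 → 𝕜}

theorem tendsto_slope_of_hasStrictDerivAt {ι : Type*} {l : Filter ι} {F' c : 𝕜} {x y : ι → 𝕜}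
    (hF : HasStrictDerivAt F F' c) (hx : Tendsto x l (𝓝 c)) (hy : Tendsto y l (𝓝 c))
    (hne : ∀ᶠ i in l, y i ≠ x i) : Tendsto (fun i => slope F (x i) (y i)) l (𝓝 F') := by
  have hlim := (hF.isLittleO.comp_tendsto (hy.prodMk_nhds hx)).tendsto_div_nhds_zero.add_const F'
  rw [zero_add] at hlim
  refine hlim.congr' (hne.mono fun i hi => ?_)
  have hi' := sub_ne_zero.mpr hi
  simp only [Function.comp_apply, ContinuousLinearMap.toSpanSingleton_apply, smul_eq_mul,
    slope_def_field]
  field_simp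
  ring

theorem continuousOn_slope_comp {X : Type*} [TopologicalSpace X] {x y : X → 𝕜} {I : Set X}
    {Ω : Set 𝕜} (hF : ContinuousOn F Ω) (hx : ContinuousOn x I) (hy : ContinuousOn y I)
    (hxΩ : MapsTo x I Ω) (hyΩ : MapsTo y I Ω) (hne : ∀ t ∈ I, y t ≠ x t) :
    ContinuousOn (fun t => slope F (x t) (y t)) I :=
  ((hy.sub hx).inv₀ fun t ht => sub_ne_zero.mpr (hne t ht)).smul
    ((hF.comp hy hyΩ).sub (hF.comp hx hxΩ))

theorem norm_slope_le_of_lipschitzOnWith {S : Set 𝕜} {L : ℝ≥0} {x y : 𝕜}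
    (hF : LipschitzOnWith L F S) (hx : x ∈ S) (hy : y ∈ S) : ‖slope F x y‖ ≤ L := by
  rw [slope_def_field, norm_div, ← dist_eq_norm, ← dist_eq_norm]
  exact div_le_of_le_mul₀ dist_nonneg L.2 (hF.dist_le_mul _ hy _ hx)

end Slope

theorem eq_mul_exp_integral {g y : ℝ → ℂ} {a b : ℝ} (hab : a ≤ b) (hg : ContinuousOn g (Icc a b))
    (hy : ∀ t ∈ Icc a b, HasDerivWithinAt y (g t * y t) (Icc a b) t) :
    y b = y a * Complex.exp (∫ t in a..b, g t) := by
  have hint : ∀ t ∈ Icc a b,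
      HasDerivWithinAt (fun t => ∫ τ in a..t, g τ) (g t) (Icc a b) t := fun t ht => by
    have := Fact.mk ht
    exact integral_hasDerivWithinAt_right
      ((hg.mono (Icc_subset_Icc_right ht.2)).intervalIntegrable_of_Icc ht.1)
      (hg.stronglyMeasurableAtFilter_nhdsWithin measurableSet_Icc t) (hg t ht)
  have hconst : ∀ t ∈ Icc a b, HasDerivWithinAt
      (fun t => y t * Complex.exp (-∫ τ in a..t, g τ)) 0 (Icc a b) t := fun t ht => by
    refine ((hy t ht).mul (hint t ht).neg.cexp).congr_deriv ?_
    ring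
  have heq := constant_of_derivWithin_zero (fun t ht => (hconst t ht).differentiableWithinAt)
    (fun t ht => (hconst t (Ico_subset_Icc_self ht)).derivWithin
      (uniqueDiffOn_Icc (ht.1.trans_lt ht.2) t (Ico_subset_Icc_self ht))) b (right_mem_Icc.mpr hab)
  rw [integral_same, neg_zero, Complex.exp_zero, mul_one] at heq
  rw [← heq, mul_assoc, ← Complex.exp_add, neg_add_cancel, Complex.exp_zero, mul_one]

theorem integralCurve_sub_eq_mul_exp {F : ℂ → ℂ} {γ u : ℝ → ℂ} {a b : ℝ} (hab : a ≤ b)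
    (hγ : IsIntegralCurveOn γ (fun _ => F) (Icc a b))
    (hu : IsIntegralCurveOn u (fun _ => F) (Icc a b)) (hne : ∀ t ∈ Icc a b, u t ≠ γ t)
    (hslope : ContinuousOn (fun t => slope F (γ t) (u t)) (Icc a b)) :
    u b - γ b = (u a - γ a) * Complex.exp (∫ t in a..b, slope F (γ t) (u t)) :=
  eq_mul_exp_integral (y := fun t => u t - γ t) hab hslope fun t ht =>
    ((hu t ht).sub (hγ t ht)).congr_deriv <| by
      rw [slope_def_field, div_mul_cancel₀ _ (sub_ne_zero.mpr (hne t ht))]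

theorem tendsto_integral_slope {ι : Type*} {l : Filter ι} [l.IsCountablyGenerated] {F : ℂ → ℂ}
    {Ω : Set ℂ} {S : ℝ → Set ℂ} {L : ℝ≥0} {x : ℝ → ℂ} {y : ι → ℝ → ℂ} {a b : ℝ} (hab : a ≤ b)
    (hΩ : IsOpen Ω) (hF : DifferentiableOn ℂ F Ω) (hxΩ : MapsTo x (Icc a b) Ω)
    (hlip : ∀ t ∈ Icc a b, LipschitzOnWith L F (S t)) (hxS : ∀ t ∈ Icc a b, x t ∈ S t)
    (hyS : ∀ᶠ i in l, ∀ t ∈ Icc a b, y i t ∈ S t \ {x t})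
    (hcont : ∀ᶠ i in l, ContinuousOn (fun t => slope F (x t) (y i t)) (Icc a b))
    (hlim : ∀ t ∈ Icc a b, Tendsto (fun i => y i t) l (𝓝 (x t))) :
    Tendsto (fun i => ∫ t in a..b, slope F (x t) (y i t)) l (𝓝 (∫ t in a..b, deriv F (x t))) := by
  have hIoc : uIoc a b ⊆ Icc a b := uIoc_of_le hab ▸ Ioc_subset_Icc_self
  have hpointwise : ∀ t ∈ Icc a b,
      Tendsto (fun i => slope F (x t) (y i t)) l (𝓝 (deriv F (x t))) := fun t ht =>
    tendsto_slope_of_hasStrictDerivAt (hF.analyticAt (hΩ.mem_nhds (hxΩ ht))).hasStrictDerivAt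
      tendsto_const_nhds (hlim t ht) (hyS.mono fun _ hi => (hi t ht).2)
  refine tendsto_integral_filter_of_dominated_convergence (fun _ => (L : ℝ)) ?_ ?_
    intervalIntegrable_const (ae_of_all _ fun t ht => hpointwise t (hIoc ht))
  · filter_upwards [hcont] with i hi
    exact (hi.mono hIoc).aestronglyMeasurable measurableSet_uIoc
  · filter_upwards [hyS] with i hi
    exact ae_of_all _ fun t ht => norm_slope_le_of_lipschitzOnWith (hlip t (hIoc ht))
      (hxS t (hIoc ht)) (hi t (hIoc ht)).1

theorem hasDerivAt_flow {F : ℂ → ℂ} {Ω : Set ℂ} {Φ : ℂ → ℝ → ℂ} {w : ℂ} {a b : ℝ} (hab : a ≤ b)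
    (hΩ : IsOpen Ω) (hF : DifferentiableOn ℂ F Ω)
    (hΦ : ∀ᶠ z in 𝓝 w, IsIntegralCurveOn (Φ z) (fun _ => F) (Icc a b))
    (hinit : ∀ᶠ z in 𝓝 w, Φ z a = z) (hΦw : MapsTo (Φ w) (Icc a b) Ω) :
    HasDerivAt (fun z => Φ z b) (Complex.exp (∫ t in a..b, deriv F (Φ w t))) w := by
  have hγ := hΦ.self_of_nhds
  obtain ⟨ρ, hρ, L, htube⟩ := exists_lipschitzOnWith_closedBall
    (isCompact_Icc.image_of_continuousOn hγ.continuousOn) hΩ hΦw.image_subset hF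
  rw [forall_mem_image] at htube
  have hlip := fun t (ht : t ∈ Icc a b) => (htube ht).2
  have hmem := eventually_flow_mem_closedBall_diff_singleton hρ hlip hΦ hinit
  have hcont : ∀ᶠ z in 𝓝[≠] w, ContinuousOn (fun t => slope F (Φ w t) (Φ z t)) (Icc a b) := by
    filter_upwards [hmem, nhdsWithin_le_nhds hΦ] with z hz hcurve
    exact continuousOn_slope_comp hF.continuousOn hγ.continuousOn hcurve.continuousOn hΦw
      (fun t ht => (htube ht).1 (hz t ht).1) fun t ht => (hz t ht).2
  have hexp : ∀ᶠ z in 𝓝[≠] w, Complex.exp (∫ t in a..b, slope F (Φ w t) (Φ z t)) =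
      slope (fun z => Φ z b) w z := by
    filter_upwards [hmem, hcont, nhdsWithin_le_nhds hΦ, nhdsWithin_le_nhds hinit,
      self_mem_nhdsWithin] with z hz hzcont hcurve hz0 hne
    rw [slope_def_field, integralCurve_sub_eq_mul_exp hab hγ hcurve (fun t ht => (hz t ht).2)
      hzcont, hz0, hinit.self_of_nhds, mul_div_cancel_left₀ _ (sub_ne_zero.mpr hne)]
  rw [hasDerivAt_iff_tendsto_slope]
  refine Tendsto.congr' hexp (Complex.continuous_exp.continuousAt.tendsto.comp
    (tendsto_integral_slope hab hΩ hF hΦw hlip (fun t _ => mem_closedBall_self hρ.le) hmem hcont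
      fun t ht => ?_))
  exact ((tendstoUniformlyOn_flow hρ hlip hΦ hinit).tendsto_at ht).mono_left nhdsWithin_le_nhds

end HolomorphicFlow

section Generator

variable {f : ℂ → ℂ} {u : ℝ → ℂ} {z : ℂ} {t : ℝ}

theorem IsCauchySolution.isIntegralCurveOn (hu : IsCauchySolution f z u) :
    IsIntegralCurveOn u (fun _ => -f) (Ici 0) := fun t ht => (hu.2 t ht).2

theorem differentiableOn_cauchySolution {Φ : ℂ → ℝ → ℂ} (hf : DifferentiableOn ℂ f (ball 0 1))
    (hΦ : ∀ z ∈ ball (0 : ℂ) 1, IsCauchySolution f z (Φ z)) (ht : 0 ≤ t) :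
    DifferentiableOn ℂ (fun z => Φ z t) (ball 0 1) := fun w hw => by
  have hnhds := isOpen_ball.mem_nhds hw
  have hcurve : ∀ᶠ z in 𝓝 w, IsIntegralCurveOn (Φ z) (fun _ => -f) (Icc 0 t) := by
    filter_upwards [hnhds] with z hz
    exact (hΦ z hz).isIntegralCurveOn.mono Icc_subset_Ici_self
  have hinit : ∀ᶠ z in 𝓝 w, Φ z 0 = z := by
    filter_upwards [hnhds] with z hz
    exact (hΦ z hz).1
  exact (hasDerivAt_flow ht isOpen_ball hf.neg hcurve hinit
    fun τ hτ => ((hΦ w hw).2 τ hτ.1).1).differentiableAt.differentiableWithinAt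

theorem IsGenerator.norm_cauchySolution_le (hf : IsGenerator f) (hf0 : f 0 = 0)
    (hu : IsCauchySolution f z u) (ht : 0 ≤ t) : ‖u t‖ ≤ ‖z‖ := by
  obtain ⟨hd, hex⟩ := hf
  choose! Φ hΦ huniq using hex
  have h0 : (0 : ℂ) ∈ ball (0 : ℂ) 1 := mem_ball_self one_pos
  have hz : z ∈ ball (0 : ℂ) 1 := hu.1 ▸ (hu.2 0 le_rfl).1
  have hzero : IsCauchySolution f 0 fun _ => 0 := by
    refine ⟨rfl, fun t _ => ⟨h0, ?_⟩⟩
    rw [hf0, neg_zero]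
    exact hasDerivWithinAt_const t (Ici 0) 0
  rw [huniq z hz u hu ht]
  exact Complex.norm_le_norm_of_mapsTo_ball (differentiableOn_cauchySolution hd hΦ ht)
    (fun w hw => ball_subset_closedBall ((hΦ w hw).2 t ht).1) (huniq 0 h0 _ hzero ht).symm
    (mem_ball_zero_iff.mp hz)

theorem IsGenerator.inner_nonneg (hf : IsGenerator f) (hf0 : f 0 = 0)
    (hz : z ∈ ball (0 : ℂ) 1) : 0 ≤ inner ℝ z (f z) := by
  obtain ⟨u, hu, -⟩ := hf.2 z hz
  have hmax : IsMaxOn (fun t => ‖u t‖ ^ 2) (Ici 0) 0 := fun t ht => by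
    have hle := hf.norm_cauchySolution_le hf0 hu ht
    rw [← hu.1] at hle
    exact pow_le_pow_left₀ (norm_nonneg _) hle 2
  have hcone : (1 : ℝ) ∈ posTangentConeAt (Ici (0 : ℝ)) 0 :=
    mem_posTangentConeAt_of_segment_subset <| (convex_Ici 0).segment_subset self_mem_Ici
      (mem_Ici.mpr (by norm_num))
  have hderiv := hmax.localize.hasFDerivWithinAt_nonpos
    (hu.2 0 le_rfl).2.norm_sq.hasFDerivWithinAt hcone
  rw [ContinuousLinearMap.toSpanSingleton_apply, one_smul, hu.1, inner_neg_right] at hderiv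
  linarith

theorem re_pos_of_re_nonneg {g : ℂ → ℂ} {U : Set ℂ} {z₀ : ℂ} (hU : IsOpen U)
    (hUc : IsPreconnected U) (hg : DifferentiableOn ℂ g U) (hre : ∀ z ∈ U, 0 ≤ (g z).re)
    (hz₀ : z₀ ∈ U) (hpos : 0 < (g z₀).re) (hz : z ∈ U) : 0 < (g z).re := by
  rcases (hg.analyticOnNhd hU).is_constant_or_isOpen hUc with ⟨c, hc⟩ | hopen
  · rwa [hc z hz, ← hc z₀ hz₀]
  · have hsub : g '' U ⊆ interior {ζ : ℂ | 0 ≤ ζ.re} :=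
      interior_maximal (image_subset_iff.mpr hre) (hopen U Subset.rfl hU)
    rw [Complex.interior_setOfPred_le_re] at hsub
    exact hsub (mem_image_of_mem g hz)

theorem mul_dslope_zero (hf0 : f 0 = 0) (z : ℂ) : z * dslope f 0 z = f z := by
  simpa only [sub_zero, smul_eq_mul, hf0] using sub_smul_dslope f 0 z

theorem IsGenerator.re_dslope_pos (hf : IsGenerator f) (hf0 : f 0 = 0) (hq : 0 < (deriv f 0).re)
    (hz : z ∈ ball (0 : ℂ) 1) : 0 < (dslope f 0 z).re := by
  rw [← dslope_same] at hq
  have hnonneg : ∀ z ∈ ball (0 : ℂ) 1, 0 ≤ (dslope f 0 z).re := fun z hz => by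
    rcases eq_or_ne z 0 with rfl | hne
    · exact hq.le
    have hinner := hf.inner_nonneg hf0 hz
    rw [← mul_dslope_zero hf0 z, Complex.inner, mul_right_comm, Complex.mul_conj',
      ← Complex.ofReal_pow, Complex.re_ofReal_mul] at hinner
    exact nonneg_of_mul_nonneg_right hinner (pow_pos (norm_pos_iff.mpr hne) 2)
  exact re_pos_of_re_nonneg isOpen_ball (convex_ball 0 1).isPreconnected
    ((Complex.differentiableOn_dslope (ball_mem_nhds 0 one_pos)).mpr hf.1) hnonneg
    (mem_ball_self one_pos) hq hz

theorem IsGenerator.exists_eq_id_mul (hf : IsGenerator f) (hf0 : f 0 = 0)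
    (hq : 0 < (deriv f 0).re) : ∃ p : ℂ → ℂ, DifferentiableOn ℂ p (ball 0 1) ∧
      (∀ z ∈ ball (0 : ℂ) 1, 0 < (p z).re) ∧ p 0 = deriv f 0 ∧ f = fun z => z * p z :=
  ⟨dslope f 0, (Complex.differentiableOn_dslope (ball_mem_nhds 0 one_pos)).mpr hf.1,
    fun _ => hf.re_dslope_pos hf0 hq, dslope_same f 0, funext fun z => (mul_dslope_zero hf0 z).symm⟩

end Generator

section Resolvent

open Function

variable {p : ℂ → ℂ} {r m s : ℝ} {w z ζ : ℂ}

theorem one_add_mul_le_norm (hr : 0 ≤ r) (hζ : m ≤ ζ.re) : 1 + r * m ≤ ‖1 + r * ζ‖ := by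
  refine le_trans ?_ (Complex.re_le_norm _)
  rw [Complex.add_re, Complex.one_re, Complex.re_ofReal_mul]
  gcongr

theorem one_le_norm_one_add_mul (hr : 0 ≤ r) (hζ : 0 ≤ ζ.re) : 1 ≤ ‖1 + r * ζ‖ := by
  simpa only [mul_zero, add_zero] using one_add_mul_le_norm hr hζ

theorem one_add_mul_ne_zero (hr : 0 ≤ r) (hζ : 0 ≤ ζ.re) : 1 + r * ζ ≠ 0 :=
  norm_pos_iff.mp (one_pos.trans_le (one_le_norm_one_add_mul hr hζ))

theorem add_mul_eq_iff_isFixedPt (hr : 0 ≤ r) (hp : 0 ≤ (p z).re) :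
    z + r * (z * p z) = w ↔ IsFixedPt (fun z => w / (1 + r * p z)) z := by
  rw [IsFixedPt, div_eq_iff (one_add_mul_ne_zero hr hp), eq_comm]
  ring_nf

theorem differentiableOn_div_one_add_mul (hr : 0 ≤ r) (hd : DifferentiableOn ℂ p (ball 0 1))
    (hp : ∀ z ∈ ball (0 : ℂ) 1, 0 ≤ (p z).re) (U : Set ℂ) :
    DifferentiableOn ℂ (uncurry fun w z => w / (1 + r * p z)) (U ×ˢ ball 0 1) :=
  differentiableOn_fst.mul (((differentiableOn_const 1).add
    ((hd.comp differentiableOn_snd mapsTo_snd_prod).const_mul (r : ℂ))).inv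
      fun _ hx => one_add_mul_ne_zero hr (hp _ (mem_prod.mp hx).2))

theorem mapsTo_div_one_add_mul (hr : 0 ≤ r) (hp : ∀ z ∈ ball (0 : ℂ) 1, 0 ≤ (p z).re)
    (hw : ‖w‖ ≤ s) : MapsTo (fun z => w / (1 + r * p z)) (ball 0 1) (closedBall 0 s) :=
  fun z hz => by
    rw [mem_closedBall_zero_iff, norm_div]
    exact (div_le_self (norm_nonneg w) (one_le_norm_one_add_mul hr (hp z hz))).trans hw

theorem existsUnique_add_mul_eq (hr : 0 ≤ r) (hd : DifferentiableOn ℂ p (ball 0 1))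
    (hp : ∀ z ∈ ball (0 : ℂ) 1, 0 ≤ (p z).re) (hw : w ∈ ball (0 : ℂ) 1) :
    ∃! z, z ∈ ball (0 : ℂ) 1 ∧ z + r * (z * p z) = w := by
  have hsec : DifferentiableOn ℂ (fun z => w / (1 + r * p z)) (ball 0 1) :=
    (differentiableOn_div_one_add_mul hr hd hp {w}).comp
      ((differentiableOn_const w).prodMk differentiableOn_id) fun z hz => ⟨rfl, hz⟩
  refine (existsUnique_congr fun z => and_congr_right fun hz =>
    add_mul_eq_iff_isFixedPt hr (hp z hz)).mpr ?_
  exact existsUnique_isFixedPt (mem_ball_zero_iff.mp hw) hsec (mapsTo_div_one_add_mul hr hp le_rfl)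

theorem isResolventMap_nonlinearResolvent (hr : 0 ≤ r) (hd : DifferentiableOn ℂ p (ball 0 1))
    (hp : ∀ z ∈ ball (0 : ℂ) 1, 0 ≤ (p z).re) :
    IsResolventMap (fun z => z * p z) r (nonlinearResolvent (fun z => z * p z) r) := by
  set f : ℂ → ℂ := fun z => z * p z
  have hunique : ∀ w ∈ ball (0 : ℂ) 1, ∃! z, z ∈ ball (0 : ℂ) 1 ∧ z + r * f z = w := fun w hw =>
    existsUnique_add_mul_eq hr hd hp hw
  have hmem : MapsTo (nonlinearResolvent f r) (ball 0 1) (ball 0 1) := fun w hw =>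
    invFunOn_mem (hunique w hw).exists
  have heq : ∀ w ∈ ball (0 : ℂ) 1,
      nonlinearResolvent f r w + r * f (nonlinearResolvent f r w) = w := fun w hw =>
    invFunOn_eq (hunique w hw).exists
  refine ⟨fun w hw => ?_, hmem, fun w hw z hz => ⟨fun hzw => ?_, fun hzw => hzw ▸ heq w hw⟩⟩
  · obtain ⟨s, hws, hs⟩ := exists_between (mem_ball_zero_iff.mp hw)
    have hsub : ball (0 : ℂ) s ⊆ ball 0 1 := ball_subset_ball hs.le
    have hdiff : DifferentiableOn ℂ (nonlinearResolvent f r) (ball 0 s) :=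
      differentiableOn_fixedPoint isOpen_ball hs
        (differentiableOn_div_one_add_mul hr hd hp (ball 0 s))
        (fun w hw => mapsTo_div_one_add_mul hr hp (mem_ball_zero_iff.mp hw).le)
        (hmem.mono_left hsub) fun w hw =>
          (add_mul_eq_iff_isFixedPt hr (hp _ (hmem (hsub hw)))).mp (heq w (hsub hw))
    exact (hdiff.differentiableAt
      (isOpen_ball.mem_nhds (mem_ball_zero_iff.mpr hws))).differentiableWithinAt
  · exact (hunique w hw).unique ⟨hz, hzw⟩ ⟨hmem hw, heq w hw⟩

theorem norm_mul_one_add_le_of_add_mul_eq (hr : 0 ≤ r) (hζ : m ≤ ζ.re)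
    (hz : z + r * (z * ζ) = w) : ‖z‖ * (1 + r * m) ≤ ‖w‖ := by
  calc ‖z‖ * (1 + r * m) ≤ ‖z‖ * ‖1 + r * ζ‖ := by
        gcongr
        exact one_add_mul_le_norm hr hζ
    _ = ‖w‖ := by rw [← norm_mul, ← hz]; ring_nf

theorem dist_one_add_mul_le (hr : 0 ≤ r) (hm : 0 < m) (hζ : m ≤ ζ.re)
    (hz : z + r * (z * ζ) = w) (q : ℂ) : dist w ((1 + r * q) * z) ≤ ‖w‖ / m * dist ζ q := by
  have hrz : r * ‖z‖ ≤ ‖w‖ / m := by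
    rw [le_div_iff₀ hm]
    linarith [norm_mul_one_add_le_of_add_mul_eq hr hζ hz, norm_nonneg z]
  have hsub : w - (1 + r * q) * z = r * z * (ζ - q) := by
    rw [← hz]
    ring
  rw [dist_eq_norm, dist_eq_norm, hsub, norm_mul, norm_mul, Complex.norm_of_nonneg hr]
  gcongr

theorem tendstoUniformlyOn_one_add_mul_resolvent {G : ℝ → ℂ → ℂ} {K : Set ℂ}
    (hd : ContinuousOn p (ball 0 1)) (hp : ∀ z ∈ ball (0 : ℂ) 1, 0 < (p z).re)
    (hG : ∀ r, 0 < r → ∀ w ∈ ball (0 : ℂ) 1, G r w ∈ ball (0 : ℂ) 1 ∧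
      G r w + r * (G r w * p (G r w)) = w)
    (hK : IsCompact K) (hK1 : K ⊆ ball 0 1) :
    TendstoUniformlyOn (fun (r : ℝ) w => (1 + r * p 0) * G r w) id atTop K := by
  obtain ⟨s, hs, hKs⟩ := exists_lt_subset_ball hK.isClosed hK1
  have hs1 : closedBall (0 : ℂ) s ⊆ ball 0 1 := closedBall_subset_ball hs
  obtain ⟨m, hm, hpm⟩ := (isCompact_closedBall (0 : ℂ) s).exists_forall_le'
    (Complex.continuous_re.comp_continuousOn (hd.mono hs1)) (a := 0) fun z hz => hp z (hs1 hz)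
  have hGm : ∀ r, 0 < r → ∀ w ∈ K, m ≤ (p (G r w)).re := fun r hr w hw => by
    obtain ⟨hGw, heq⟩ := hG r hr w (hK1 hw)
    have hle := norm_mul_one_add_le_of_add_mul_eq hr.le (hp _ hGw).le heq
    rw [mul_zero, add_zero, mul_one] at hle
    exact hpm _ (mem_closedBall_zero_iff.mpr (hle.trans (mem_ball_zero_iff.mp (hKs hw)).le))
  rw [Metric.tendstoUniformlyOn_iff]
  intro ε hε
  obtain ⟨δ, hδ, hpδ⟩ := Metric.continuousAt_iff.mp
    (hd.continuousAt (ball_mem_nhds 0 one_pos)) (ε * m) (mul_pos hε hm)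
  filter_upwards [eventually_gt_atTop 0, eventually_gt_atTop (1 / (m * δ))] with r hr hrδ w hw
  obtain ⟨-, heq⟩ := hG r hr w (hK1 hw)
  have hw1 : ‖w‖ ≤ 1 := (mem_ball_zero_iff.mp (hK1 hw)).le
  have hsmall : ‖G r w‖ < δ := by
    rw [div_lt_iff₀ (mul_pos hm hδ)] at hrδ
    have hle := (norm_mul_one_add_le_of_add_mul_eq hr.le (hGm r hr w hw) heq).trans hw1
    by_contra! hge
    nlinarith [mul_le_mul_of_nonneg_right hge (mul_pos hr hm).le]
  calc dist (id w) ((1 + r * p 0) * G r w) ≤ ‖w‖ / m * dist (p (G r w)) (p 0) :=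
        dist_one_add_mul_le hr.le hm (hGm r hr w hw) heq (p 0)
    _ ≤ 1 / m * dist (p (G r w)) (p 0) := by gcongr
    _ < ε := by
        rw [one_div_mul_eq_div, div_lt_iff₀ hm]
        exact hpδ (by rwa [dist_zero_right])

end Resolvent

theorem mainTheorem8 (f : ℂ → ℂ) (q : ℂ) (hf : IsGenerator f) (hf0 : f 0 = 0)
    (hfq : deriv f 0 = q) (hq : 0 < q.re) :
    (∀ r : ℝ, 0 < r → IsResolventMap f r (nonlinearResolvent f r)) ∧
    ∀ K : Set ℂ, IsCompact K → K ⊆ ball 0 1 →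
      TendstoUniformlyOn (fun (r : ℝ) (z : ℂ) => (1 + (r : ℂ) * q) * nonlinearResolvent f r z)
        (fun z => z) atTop K := by
  obtain ⟨p, hd, hp, hp0, rfl⟩ := hf.exists_eq_id_mul hf0 (hfq ▸ hq)
  have hres : ∀ r : ℝ, 0 < r → IsResolventMap _ r (nonlinearResolvent (fun z => z * p z) r) :=
    fun r hr => isResolventMap_nonlinearResolvent hr.le hd fun z hz => (hp z hz).le
  refine ⟨hres, fun K hK hK1 => ?_⟩
  rw [← hfq, ← hp0]
  refine tendstoUniformlyOn_one_add_mul_resolvent hd.continuousOn hp (fun r hr w hw => ?_) hK hK1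
  obtain ⟨-, hmem, heq⟩ := hres r hr
  exact ⟨hmem hw, (heq w hw _ (hmem hw)).mpr rfl⟩
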